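/- Let $k\ge 1$ be an integer and let $l,j$ be integers with $l>0$ and $j\ge 2-l$. Consider the set of all integer sequences $\lambda_1,\ldots,\lambda_k$ satisfying \[ \lambda_1 \;\ge\; l\left\lceil \frac{k\lambda_2}{k-1}\right\rceil+(j-1)(\lambda_2+\lambda_4+\lambda_6+\cdots)+(l-1)(\lambda_3+\lambda_5+\lambda_7+\cdots) \] and \[ \frac{\lambda_2}{k-1}\ge\frac{\lambda_3}{k-2}\ge\cdots\ge\frac{\lambda_{k-1}}{2}\ge\frac{\lambda_k}{1}\ge 0 \] (for $k=1$ the constraints just say $\lambda_1\ge 0$). Then every such sequence has nonnegative parts, for every $n\ge 0$ only finitely many of them, say $p(n)$, have weight $\lambda_1+\cdots+\lambda_k=n$, and \[ \sum_{n\ge 0}p(n)\,q^n=\frac{1}{1-q}\prod_{i=1}^{k-1}\frac{1}{1-q^{\,il+ij+l}} \] as formal power series. -/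

import Mathlib

/-- The part `lam_i` of a sequence `lam_1, …, lam_k` of integers, with the parts numbered from `1`
(and `lam_i = 0` when there is no part with number `i`). -/
def part {k : ℕ} (lam : Fin k → ℤ) (i : ℕ) : ℤ :=
  if h : 1 ≤ i ∧ i ≤ k then lam ⟨i - 1, by omega⟩ else 0

/-- The set of integer sequences `lam_1, …, lam_k` that satisfy the first constraint with
parameters `l`, `j`, and the lecture hall chain
`lam_2 / (k - 1) ≥ lam_3 / (k - 2) ≥ ⋯ ≥ lam_k / 1 ≥ 0`. -/
def lectureHallVariation (k : ℕ) (l j : ℤ) : Set (Fin k → ℤ) :=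
  {lam |
    part lam 1 ≥ l * ⌈(k : ℚ) * (part lam 2 : ℚ) / ((k : ℚ) - 1)⌉
      + (j - 1) * (∑ i ∈ Finset.Icc 2 k with Even i, part lam i)
      + (l - 1) * (∑ i ∈ Finset.Icc 3 k with Odd i, part lam i) ∧
    (∀ i : ℕ, 2 ≤ i → i < k →
      (part lam i : ℚ) / ((k : ℚ) - i + 1) ≥ (part lam (i + 1) : ℚ) / ((k : ℚ) - i)) ∧
    part lam k ≥ 0}

/-- The sequences in `S` of weight `lam_1 + ⋯ + lam_k = n`. -/
def ofWeight {k : ℕ} (S : Set (Fin k → ℤ)) (n : ℕ) : Set (Fin k → ℤ) :=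
  {lam | lam ∈ S ∧ ∑ i, lam i = (n : ℤ)}

/-- The weight generating function `∑ₙ #{lam ∈ S : lam_1 + ⋯ + lam_k = n} qⁿ` of a set `S` of
sequences with nonnegative parts, of which only finitely many have any given weight. -/
noncomputable def weightGenFun {k : ℕ} (S : Set (Fin k → ℤ)) : PowerSeries ℚ :=
  PowerSeries.mk fun n => ((ofWeight S n).ncard : ℚ)

/-! Number the parts by denominators. Write A_m for `altSum m b` and C for `b m + ceilRatio b m`,
the least admissible entry m + 1. Given its neighbours, an entry of a lecture hall sequence ranges
over an integer interval, so reflecting all entries of parity opposite to m in their intervals is an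
involution. It fixes A_m and replaces A_{m-1} by 2 A_m - C - A_{m-1} (`altSum_pred_reflect`), hence
turns the weight (2l+j) A_m - l A_{m-1} into l C + j A_m + l A_{m-1} (`HasGenFun.reflect`). Let
F_m(l, j) be the generating function for the weight l A_m + j A_{m-1}. Entry m + 1 is C plus a free
excess t, and l A_{m+1} + j A_m = l t + (l C + j A_m + l A_{m-1}). So F_{m+1}(l, j) = F_m(2l+j, -l)
/ (1 - q^l), which gives the product (`hasGenFun_lectureHall`). In the variation the bound on the
first part is tuned so that, with m = k - 1, the total weight is t + (l C + j A_m + l A_{m-1}); the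
series is therefore F_m(2l+j, -l) / (1 - q). -/

/-! ### Generating functions of weighted sets -/

/-- The set `S`, weighted by `w`, has finitely many elements of each weight, all weights are
nonnegative, and `F` is the weight generating function of `S`. -/
def HasGenFun {α : Type*} (S : Set α) (w : α → ℤ) (F : PowerSeries ℚ) : Prop :=
  (∀ a ∈ S, 0 ≤ w a) ∧ (∀ n : ℕ, {a | a ∈ S ∧ w a = n}.Finite) ∧
    ∀ n : ℕ, PowerSeries.coeff n F = ({a | a ∈ S ∧ w a = n}.ncard : ℚ)

theorem HasGenFun.of_bijOn {α β : Type*} {S : Set α} {T : Set β} {w : α → ℤ} {v : β → ℤ}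
    {F : PowerSeries ℚ} (h : HasGenFun S w F) {f : α → β} (hf : Set.BijOn f S T)
    (hw : ∀ a ∈ S, v (f a) = w a) : HasGenFun T v F := by
  have key : ∀ n : ℕ, {b | b ∈ T ∧ v b = n} = f '' {a | a ∈ S ∧ w a = n} := by
    intro n
    ext b
    constructor
    · rintro ⟨hb, hv⟩
      obtain ⟨a, ha, rfl⟩ := hf.surjOn hb
      exact ⟨a, ⟨ha, by rw [← hw a ha, hv]⟩, rfl⟩
    · rintro ⟨a, ⟨ha, hwa⟩, rfl⟩
      exact ⟨hf.mapsTo ha, by rw [hw a ha, hwa]⟩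
  refine ⟨?_, ?_, ?_⟩
  · intro b hb
    obtain ⟨a, ha, rfl⟩ := hf.surjOn hb
    rw [hw a ha]
    exact h.1 a ha
  · intro n
    rw [key]
    exact (h.2.1 n).image f
  · intro n
    rw [key, (hf.injOn.mono fun a ha => ha.1).ncard_image, h.2.2 n]

theorem hasGenFun_singleton {α : Type*} (a : α) (w : α → ℤ) (hw : w a = 0) :
    HasGenFun {a} w 1 := by
  refine ⟨?_, fun n => (Set.finite_singleton a).subset fun b hb => hb.1, ?_⟩
  · rintro b rfl
    exact hw.ge
  · intro n
    rw [PowerSeries.coeff_one]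
    split_ifs with hn
    · subst hn
      have : {b | b ∈ ({a} : Set α) ∧ w b = (0 : ℕ)} = {a} := by
        ext b
        simp only [Set.mem_singleton_iff, Set.mem_ofPred_eq]
        exact ⟨fun h => h.1, fun h => ⟨h, by rw [h, hw]; rfl⟩⟩
      rw [this, Set.ncard_singleton]
      simp
    · have : {b | b ∈ ({a} : Set α) ∧ w b = (n : ℤ)} = ∅ := by
        ext b
        simp only [Set.mem_singleton_iff, Set.mem_ofPred_eq, Set.mem_empty_iff_false, iff_false]
        rintro ⟨rfl, h⟩
        omega
      rw [this, Set.ncard_empty]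
      simp

/-- Adjoining a free multiplicity of a part of size `c` multiplies the generating function by
`1 / (1 - X ^ c)`. -/
theorem HasGenFun.nat_prod {α : Type*} {S : Set α} {w : α → ℤ} {F : PowerSeries ℚ}
    (h : HasGenFun S w F) {c : ℕ} (hc : 0 < c) :
    HasGenFun {x : ℕ × α | x.2 ∈ S} (fun x => c * x.1 + w x.2)
      ((1 - PowerSeries.X ^ c)⁻¹ * F) := by
  set fib : ℕ → Set α := fun n => {a | a ∈ S ∧ w a = n} with hfib
  set fib' : ℕ → Set (ℕ × α) := fun n => {x | x.2 ∈ S ∧ (c * x.1 + w x.2 : ℤ) = n} with hfib'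
  set up : ℕ × α → ℕ × α := fun x => (x.1 + 1, x.2) with hup
  have up_inj : Function.Injective up := by
    rintro ⟨s, a⟩ ⟨t, b⟩ hst
    simpa [hup] using hst
  have zero_inj : Function.Injective (fun a : α => ((0, a) : ℕ × α)) := by
    intro a b hab
    simpa using hab
  have lt_case : ∀ n, n < c → fib' n = (fun a => (0, a)) '' fib n := by
    intro n hn
    ext ⟨t, a⟩
    simp only [hfib, hfib', Set.mem_ofPred_eq, Set.mem_image, Prod.mk.injEq]
    constructor
    · rintro ⟨ha, hw⟩
      have h0 := h.1 a ha
      rcases Nat.eq_zero_or_pos t with rfl | ht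
      · exact ⟨a, ⟨ha, by simpa using hw⟩, rfl, rfl⟩
      · exfalso
        have : (c : ℤ) * 1 ≤ c * t := by gcongr; exact_mod_cast ht
        omega
    · rintro ⟨a, ⟨ha, hw⟩, rfl, rfl⟩
      exact ⟨ha, by simpa using hw⟩
  -- Either the multiplicity is zero or one copy can be removed: this recurrence expresses
  -- multiplication by `1 - X ^ c`.
  have ge_case : ∀ n, fib' (n + c) = (fun a => (0, a)) '' fib (n + c) ∪ up '' fib' n := by
    intro n
    ext ⟨t, a⟩
    simp only [hfib, hfib', hup, Set.mem_ofPred_eq, Set.mem_image, Prod.mk.injEq, Set.mem_union,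
      Prod.exists]
    constructor
    · rintro ⟨ha, hw⟩
      rcases t with _ | t
      · exact Or.inl ⟨a, ⟨ha, by simpa using hw⟩, rfl, rfl⟩
      · refine Or.inr ⟨t, a, ⟨ha, ?_⟩, rfl, rfl⟩
        push_cast at hw
        linarith
    · rintro (⟨a, ⟨ha, hw⟩, rfl, rfl⟩ | ⟨t, a, ⟨ha, hw⟩, rfl, rfl⟩)
      · exact ⟨ha, by simpa using hw⟩
      · refine ⟨ha, ?_⟩
        push_cast
        linarith
  have fin' : ∀ n, (fib' n).Finite := by
    intro n
    induction n using Nat.strong_induction_on with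
    | _ n ih =>
      rcases lt_or_ge n c with hn | hn
      · rw [lt_case n hn]
        exact (h.2.1 n).image _
      · obtain ⟨r, rfl⟩ := Nat.exists_eq_add_of_le' hn
        rw [ge_case]
        exact ((h.2.1 _).image _).union ((ih r (by omega)).image _)
  have card_zero : ∀ n, (((fun a => ((0, a) : ℕ × α)) '' fib n).ncard : ℚ)
      = PowerSeries.coeff n F := by
    intro n
    rw [Set.ncard_image_of_injective _ zero_inj, h.2.2 n]
  have series : (1 - PowerSeries.X ^ c)⁻¹ * F
      = PowerSeries.mk fun n => ((fib' n).ncard : ℚ) := by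
    have hunit : PowerSeries.constantCoeff (1 - PowerSeries.X ^ c : PowerSeries ℚ) ≠ 0 := by
      simp [hc.ne']
    symm
    rw [mul_comm, PowerSeries.eq_mul_inv_iff_mul_eq hunit]
    ext n
    rw [mul_comm, sub_mul, one_mul, map_sub, PowerSeries.coeff_X_pow_mul']
    simp only [PowerSeries.coeff_mk]
    split_ifs with hn
    · obtain ⟨r, rfl⟩ := Nat.exists_eq_add_of_le' hn
      have hd : Disjoint ((fun a => ((0, a) : ℕ × α)) '' fib (r + c)) (up '' fib' r) := by
        rw [Set.disjoint_left]
        rintro _ ⟨a, -, rfl⟩ ⟨y, -, hy⟩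
        simp [hup] at hy
      rw [ge_case, Set.ncard_union_eq hd ((h.2.1 _).image _) ((fin' r).image _), Nat.cast_add,
        card_zero, Set.ncard_image_of_injective _ up_inj, Nat.add_sub_cancel]
      ring
    · rw [lt_case n (by omega), card_zero, sub_zero]
  refine ⟨?_, fin', ?_⟩
  · rintro ⟨t, a⟩ ha
    have := h.1 a ha
    positivity
  · intro n
    rw [series, PowerSeries.coeff_mk]
    rfl

/-! ### Lecture hall sequences and rounding -/

/-- The rounded-up ratio `⌈b p / p⌉`. -/
def ceilRatio (b : ℕ → ℤ) (p : ℕ) : ℤ := ⌈(b p : ℚ) / p⌉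

/-- The lecture hall sequences `b m / m ≥ ⋯ ≥ b 1 / 1 ≥ 0`, extended by zero; the parts are numbered
by their denominators. -/
def lectureHall (m : ℕ) : Set (ℕ → ℤ) :=
  {b | b 0 = 0 ∧ (∀ p < m, b p + ceilRatio b p ≤ b (p + 1)) ∧ ∀ p, m < p → b p = 0}

/-- The sum `b m + b (m - 2) + b (m - 4) + ⋯` over positive indices. -/
def altSum : ℕ → (ℕ → ℤ) → ℤ
  | 0, _ => 0
  | 1, b => b 1
  | m + 2, b => b (m + 2) + altSum m b

theorem altSum_succ (m : ℕ) (b : ℕ → ℤ) : altSum (m + 1) b = b (m + 1) + altSum (m - 1) b := by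
  cases m <;> simp [altSum]

theorem altSum_congr (b b' : ℕ → ℤ) (m : ℕ)
    (h : ∀ p, 1 ≤ p → p ≤ m → p % 2 = m % 2 → b p = b' p) : altSum m b = altSum m b' := by
  induction m using Nat.twoStepInduction with
  | zero => rfl
  | one => exact h 1 le_rfl le_rfl rfl
  | more m ih _ =>
    simp only [altSum]
    rw [h (m + 2) (by omega) le_rfl rfl, ih fun p h1 h2 h3 => h p h1 (by omega) (by omega)]

/-- Here and in `le_sub_ceil_div_iff`, x / p ≤ y / (p + 1) is solved over the integers, once for the
least y and once for the greatest x. -/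
theorem add_ceil_div_le_iff (p : ℕ) (hp : 1 ≤ p) (x y : ℤ) :
    x + ⌈(x : ℚ) / p⌉ ≤ y ↔ ((p : ℤ) + 1) * x ≤ p * y := by
  have hp' : (0 : ℚ) < p := by exact_mod_cast hp
  rw [← le_sub_iff_add_le', Int.ceil_le, div_le_iff₀ hp', ← @Int.cast_le ℚ]
  push_cast
  constructor <;> intro h <;> linarith

theorem le_sub_ceil_div_iff (p : ℕ) (x y : ℤ) :
    x ≤ y - ⌈(y : ℚ) / (p + 1 : ℕ)⌉ ↔ ((p : ℤ) + 1) * x ≤ p * y := by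
  have hp' : (0 : ℚ) < (p + 1 : ℕ) := by positivity
  rw [le_sub_comm, Int.ceil_le, div_le_iff₀ hp', ← @Int.cast_le ℚ]
  push_cast
  constructor <;> intro h <;> linarith

/-- Turns a lower bound on an entry into an upper bound on its predecessor. At p = 0 the two differ:
the right side would say `b 0 ≤ 0`. -/
theorem add_ceilRatio_le_iff (b : ℕ → ℤ) (p : ℕ) (hp : 1 ≤ p) :
    b p + ceilRatio b p ≤ b (p + 1) ↔ b p ≤ b (p + 1) - ceilRatio b (p + 1) := by
  unfold ceilRatio
  rw [add_ceil_div_le_iff p hp, le_sub_ceil_div_iff]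

theorem ceilRatio_zero (b : ℕ → ℤ) : ceilRatio b 0 = 0 := by simp [ceilRatio]

theorem ceilRatio_one (b : ℕ → ℤ) : ceilRatio b 1 = b 1 := by simp [ceilRatio]

theorem ceilRatio_congr {b b' : ℕ → ℤ} {p : ℕ} (h : b p = b' p) :
    ceilRatio b p = ceilRatio b' p := by
  rw [ceilRatio, ceilRatio, h]

theorem ceilRatio_nonneg {b : ℕ → ℤ} {p : ℕ} (h : 0 ≤ b p) : 0 ≤ ceilRatio b p := by
  have : (0 : ℚ) ≤ b p := by exact_mod_cast h
  exact Int.ceil_nonneg (by positivity)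

theorem lectureHall_nonneg {m : ℕ} {b : ℕ → ℤ} (hb : b ∈ lectureHall m) (p : ℕ) : 0 ≤ b p := by
  induction p with
  | zero => exact hb.1.ge
  | succ p ih =>
    rcases lt_or_ge p m with hp | hp
    · have := hb.2.1 p hp
      have := ceilRatio_nonneg ih
      omega
    · exact (hb.2.2 (p + 1) (by omega)).ge

/-! ### The reflection involution -/

/-- In a lecture hall sequence of length `m`, reflect every entry whose index has the parity
opposite to `m` in the interval between the bounds that its two neighbours impose on it. -/
def reflect (m : ℕ) (b : ℕ → ℤ) (p : ℕ) : ℤ :=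
  if p < m ∧ p % 2 ≠ m % 2 then
    b (p + 1) - ceilRatio b (p + 1) + (b (p - 1) + ceilRatio b (p - 1)) - b p
  else b p

theorem reflect_of_parity_eq {m p : ℕ} (b : ℕ → ℤ) (h : p % 2 = m % 2) :
    reflect m b p = b p := if_neg fun hp => hp.2 h

theorem reflect_of_parity_ne {m p : ℕ} (b : ℕ → ℤ) (hp : p < m) (h : p % 2 ≠ m % 2) :
    reflect m b p =
      b (p + 1) - ceilRatio b (p + 1) + (b (p - 1) + ceilRatio b (p - 1)) - b p :=
  if_pos ⟨hp, h⟩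

/-- For odd m entry 0 is reflected too; there `p - 1` truncates to 0 and `ceilRatio b 1 = b 1`, so
everything cancels. -/
theorem reflect_zero {m : ℕ} {b : ℕ → ℤ} (hb : b 0 = 0) : reflect m b 0 = 0 := by
  unfold reflect
  split_ifs
  · simp [ceilRatio_zero, ceilRatio_one, hb]
  · exact hb

/-- The neighbours of a reflected entry are fixed, so its interval is unchanged and the reflected
value stays inside. -/
theorem reflect_mem {m : ℕ} {b : ℕ → ℤ} (hb : b ∈ lectureHall m) :
    reflect m b ∈ lectureHall m := by
  refine ⟨reflect_zero hb.1, ?_, ?_⟩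
  · intro p hp
    by_cases hpar : p % 2 = m % 2
    · have e := reflect_of_parity_eq b hpar
      rw [ceilRatio_congr e, e, reflect_of_parity_ne b (by omega) (by omega), Nat.add_sub_cancel]
      have := (add_ceilRatio_le_iff b (p + 1) (by omega)).1 (hb.2.1 (p + 1) (by omega))
      omega
    · have e : reflect m b (p + 1) = b (p + 1) := reflect_of_parity_eq b (by omega)
      rcases Nat.eq_zero_or_pos p with rfl | h1
      · rw [e, reflect_zero hb.1, ceilRatio_zero]
        exact lectureHall_nonneg hb 1
      · rw [add_ceilRatio_le_iff _ _ h1, ceilRatio_congr e, e, reflect_of_parity_ne b hp hpar]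
        have := hb.2.1 (p - 1) (by omega)
        rw [Nat.sub_add_cancel h1] at this
        omega
  · intro p hp
    rw [reflect, if_neg (by omega), hb.2.2 p hp]

theorem reflect_reflect {m : ℕ} {b : ℕ → ℤ} (hb : b 0 = 0) :
    reflect m (reflect m b) = b := by
  funext p
  by_cases h : p < m ∧ p % 2 ≠ m % 2
  · rcases Nat.eq_zero_or_pos p with rfl | h1
    · rw [reflect_zero (reflect_zero hb), hb]
    · have e1 : reflect m b (p + 1) = b (p + 1) := reflect_of_parity_eq b (by omega)
      have e2 : reflect m b (p - 1) = b (p - 1) := reflect_of_parity_eq b (by omega)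
      rw [reflect_of_parity_ne _ h.1 h.2, ceilRatio_congr e1, ceilRatio_congr e2, e1, e2,
        reflect_of_parity_ne _ h.1 h.2]
      ring
  · rw [reflect, if_neg h, reflect, if_neg h]

theorem reflect_bijOn (m : ℕ) : Set.BijOn (reflect m) (lectureHall m) (lectureHall m) :=
  Set.InvOn.bijOn (f' := reflect m)
    ⟨fun _ hb => reflect_reflect hb.1, fun _ hb => reflect_reflect hb.1⟩
    (fun _ => reflect_mem) fun _ => reflect_mem

theorem altSum_reflect (m : ℕ) (b : ℕ → ℤ) : altSum m (reflect m b) = altSum m b :=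
  altSum_congr _ _ _ fun _ _ _ h => reflect_of_parity_eq b h

/-- In the sum of the interval endpoints the rounded ratios telescope, and each entry of the parity
of m occurs twice except `b m`, which occurs once. A general `b'` lets m drop by 2 in the induction,
although `reflect m` depends on m. -/
theorem altSum_pred_add (b b' : ℕ → ℤ) (hb : b 0 = 0) (m : ℕ)
    (h : ∀ p, 1 ≤ p → p < m → p % 2 ≠ m % 2 →
      b' p = b (p + 1) - ceilRatio b (p + 1) + (b (p - 1) + ceilRatio b (p - 1)) - b p) :
    altSum (m - 1) b' + altSum (m - 1) b = 2 * altSum m b - (b m + ceilRatio b m) := by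
  induction m using Nat.twoStepInduction with
  | zero => simp [altSum, hb, ceilRatio_zero]
  | one =>
    simp only [Nat.sub_self, altSum, ceilRatio_one]
    ring
  | more m ih _ =>
    have h1 := ih fun p h1 h2 h3 => h p h1 (by omega) (by omega)
    have h2 := h (m + 1) (by omega) (by omega) (by omega)
    rw [Nat.add_sub_cancel] at h2
    rw [show m + 2 - 1 = m + 1 from rfl, altSum_succ, altSum_succ, altSum]
    linarith

theorem altSum_pred_reflect (m : ℕ) (b : ℕ → ℤ) (hb : b 0 = 0) :
    altSum (m - 1) (reflect m b) + altSum (m - 1) b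
      = 2 * altSum m b - (b m + ceilRatio b m) :=
  altSum_pred_add b _ hb m fun _ _ h1 h2 => reflect_of_parity_ne b h1 h2

/-! ### Prolonging a sequence by one entry -/

/-- The sequence `b` with its entries of index greater than `m` replaced by zero. -/
def trunc (m : ℕ) (b : ℕ → ℤ) (p : ℕ) : ℤ := if p ≤ m then b p else 0

theorem trunc_apply {m p : ℕ} (b : ℕ → ℤ) (h : p ≤ m) : trunc m b p = b p := if_pos h

theorem altSum_trunc {m r : ℕ} (h : r ≤ m) (b : ℕ → ℤ) : altSum r (trunc m b) = altSum r b :=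
  altSum_congr _ _ _ fun _ _ h1 _ => trunc_apply b (h1.trans h)

/-- Lecture hall sequences of length `m` prolonged by one more entry that is at least `B`. -/
def extension (m : ℕ) (B : (ℕ → ℤ) → ℤ) : Set (ℕ → ℤ) :=
  {b | trunc m b ∈ lectureHall m ∧ B (trunc m b) ≤ b (m + 1) ∧ ∀ p, m + 1 < p → b p = 0}

/-- Prolong `x.2` by the entry that exceeds the bound `B` by `x.1`. -/
def extend (m : ℕ) (B : (ℕ → ℤ) → ℤ) (x : ℕ × (ℕ → ℤ)) : ℕ → ℤ :=
  Function.update x.2 (m + 1) (x.1 + B x.2)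

theorem trunc_extend {m : ℕ} (B : (ℕ → ℤ) → ℤ) {x : ℕ × (ℕ → ℤ)} (hx : x.2 ∈ lectureHall m) :
    trunc m (extend m B x) = x.2 := by
  funext p
  unfold trunc extend
  split_ifs with h
  · rw [Function.update_of_ne (by omega)]
  · exact (hx.2.2 p (by omega)).symm

theorem extend_last (m : ℕ) (B : (ℕ → ℤ) → ℤ) (x : ℕ × (ℕ → ℤ)) :
    extend m B x (m + 1) = x.1 + B x.2 := Function.update_self ..

theorem extend_bijOn (m : ℕ) (B : (ℕ → ℤ) → ℤ) :
    Set.BijOn (extend m B) {x | x.2 ∈ lectureHall m} (extension m B) := by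
  refine Set.InvOn.bijOn
    (f' := fun b => ((b (m + 1) - B (trunc m b)).toNat, trunc m b)) ⟨?_, ?_⟩ ?_ ?_
  · intro x hx
    simp only [trunc_extend B hx, extend_last]
    ext <;> simp
  · intro b hb
    funext p
    rcases lt_trichotomy p (m + 1) with h | rfl | h
    · rw [extend, Function.update_of_ne h.ne]
      exact trunc_apply b (by omega)
    · rw [extend_last]
      have := hb.2.1
      dsimp only
      omega
    · rw [extend, Function.update_of_ne h.ne', hb.2.2 p h]
      exact if_neg (by omega)
  · intro x hx
    refine ⟨by rwa [trunc_extend B hx], ?_, ?_⟩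
    · rw [trunc_extend B hx, extend_last]
      omega
    · intro p hp
      rw [extend, Function.update_of_ne hp.ne']
      exact hx.2.2 p (by omega)
  · exact fun b hb => hb.1

theorem trunc_mem_lectureHall_iff {m : ℕ} {b : ℕ → ℤ} :
    trunc m b ∈ lectureHall m ↔ b 0 = 0 ∧ ∀ p < m, b p + ceilRatio b p ≤ b (p + 1) := by
  have key : ∀ p < m, (trunc m b p + ceilRatio (trunc m b) p ≤ trunc m b (p + 1) ↔
      b p + ceilRatio b p ≤ b (p + 1)) := by
    intro p hp
    have e := trunc_apply b hp.le
    rw [ceilRatio_congr e, e, trunc_apply b hp]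
  constructor
  · intro h
    exact ⟨by simpa [trunc] using h.1, fun p hp => (key p hp).1 (h.2.1 p hp)⟩
  · intro h
    exact ⟨by simpa [trunc] using h.1, fun p hp => (key p hp).2 (h.2 p hp),
      fun p hp => if_neg (by omega)⟩

theorem extension_eq_lectureHall (m : ℕ) :
    extension m (fun b => b m + ceilRatio b m) = lectureHall (m + 1) := by
  ext b
  have e := trunc_apply b (le_refl m)
  simp only [extension, Set.mem_ofPred_eq, trunc_mem_lectureHall_iff, ceilRatio_congr e, e]
  constructor
  · rintro ⟨⟨h0, h1⟩, h2, h3⟩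
    refine ⟨h0, fun p hp => ?_, h3⟩
    rcases Nat.lt_succ_iff_lt_or_eq.1 hp with h | rfl
    · exact h1 p h
    · exact h2
  · rintro ⟨h0, h1, h2⟩
    exact ⟨⟨h0, fun p hp => h1 p (by omega)⟩, h1 m (by omega), h2⟩

/-! ### The refined lecture hall theorem -/

theorem HasGenFun.reflect {m : ℕ} {l j : ℤ} {F : PowerSeries ℚ}
    (h : HasGenFun (lectureHall m)
      (fun b => (2 * l + j) * altSum m b + -l * altSum (m - 1) b) F) :
    HasGenFun (lectureHall m)
      (fun b => l * (b m + ceilRatio b m) + j * altSum m b + l * altSum (m - 1) b) F := by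
  refine h.of_bijOn (reflect_bijOn m) fun b hb => ?_
  have h1 := altSum_pred_reflect m b hb.1
  have e : _root_.reflect m b m = b m := reflect_of_parity_eq b rfl
  rw [altSum_reflect, e, ceilRatio_congr e]
  linear_combination l * h1

/-- The refined lecture hall theorem. -/
theorem hasGenFun_lectureHall (m : ℕ) (l j : ℤ) (hl : 0 < l) (hlj : 0 < l + j) :
    HasGenFun (lectureHall m) (fun b => l * altSum m b + j * altSum (m - 1) b)
      (∏ i ∈ Finset.range m, (1 - PowerSeries.X ^ ((i : ℤ) * (l + j) + l).toNat)⁻¹) := by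
  induction m generalizing l j with
  | zero =>
    have : lectureHall 0 = {0} := by
      ext b
      rw [Set.mem_singleton_iff]
      constructor
      · rintro ⟨h0, -, h1⟩
        funext p
        rcases Nat.eq_zero_or_pos p with rfl | hp
        · exact h0
        · exact h1 p hp
      · rintro rfl
        exact ⟨rfl, fun p hp => absurd hp (by omega), fun _ _ => rfl⟩
    rw [this, Finset.range_zero, Finset.prod_empty]
    exact hasGenFun_singleton _ _ (by simp [altSum])
  | succ m ih =>
    -- The new parameters have the same sum l + j, so both positivity conditions persist. The free
    -- excess gives the factor i = 0; the others shift by one index.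
    have h := ((ih (2 * l + j) (-l) (by omega) (by omega)).reflect).nat_prod
      (c := l.toNat) (by omega)
    rw [Finset.prod_range_succ', mul_comm, ← extension_eq_lectureHall]
    have hF : ∀ i : ℕ, ((i + 1 : ℕ) : ℤ) * (l + j) + l
        = i * (2 * l + j + -l) + (2 * l + j) := by
      intro i
      push_cast
      ring
    simp only [hF, Nat.cast_zero, zero_mul, zero_add]
    refine h.of_bijOn (extend_bijOn m _) fun x hx => ?_
    rw [altSum_succ, extend_last, Nat.add_sub_cancel, ← altSum_trunc (Nat.sub_le m 1),
      ← altSum_trunc (le_refl m), trunc_extend _ hx, Int.toNat_of_nonneg hl.le]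
    ring

/-! ### Translation between parts and denominators -/

/-- The sequence `lam` with its parts numbered by their denominators, extended by zero. -/
def byDenominator {k : ℕ} (lam : Fin k → ℤ) (p : ℕ) : ℤ := part lam (k + 1 - p)

theorem byDenominator_injective {k : ℕ} :
    Function.Injective (byDenominator : (Fin k → ℤ) → ℕ → ℤ) := by
  intro lam lam' h
  funext i
  have := congrFun h (k - i)
  simpa [byDenominator, part, show k + 1 - (k - i) = i + 1 by omega,
    Nat.succ_le_iff] using this

theorem exists_byDenominator_eq {k : ℕ} {b : ℕ → ℤ} (h0 : b 0 = 0) (h1 : ∀ p, k < p → b p = 0) :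
    ∃ lam : Fin k → ℤ, byDenominator lam = b := by
  refine ⟨fun i => b (k - i), ?_⟩
  funext p
  unfold byDenominator part
  split_ifs with h
  · exact congrArg b (by dsimp only; omega)
  · rcases Nat.eq_zero_or_pos p with rfl | hp
    · exact h0.symm
    · exact (h1 p (by omega)).symm

theorem sum_part_eq_altSum {k : ℕ} (lam : Fin k → ℤ) (m s : ℕ) (hs : 1 ≤ s) (h : m + s = k + 1) :
    ∑ i ∈ Finset.Icc s k with i % 2 = s % 2, part lam i = altSum m (byDenominator lam) := by
  induction m using Nat.twoStepInduction generalizing s with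
  | zero =>
    rw [Finset.Icc_eq_empty (by omega)]
    rfl
  | one =>
    obtain rfl : s = k := by omega
    simp [altSum, byDenominator, Finset.filter_singleton]
  | more m ih _ =>
    have : (Finset.Icc s k).filter (fun i => i % 2 = s % 2)
        = insert s ((Finset.Icc (s + 2) k).filter fun i => i % 2 = (s + 2) % 2) := by
      ext i
      simp only [Finset.mem_filter, Finset.mem_Icc, Finset.mem_insert]
      omega
    rw [this, Finset.sum_insert (by simp), ih (s + 2) (by omega) (by omega), altSum,
      byDenominator, show k + 1 - (m + 2) = s by omega]

theorem sum_even_part {m : ℕ} (lam : Fin (m + 1) → ℤ) :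
    ∑ i ∈ Finset.Icc 2 (m + 1) with Even i, part lam i = altSum m (byDenominator lam) := by
  rw [← sum_part_eq_altSum lam m 2 (by omega) (by omega)]
  simp only [Nat.even_iff, Nat.mod_self]

theorem sum_odd_part {m : ℕ} (lam : Fin (m + 1) → ℤ) :
    ∑ i ∈ Finset.Icc 3 (m + 1) with Odd i, part lam i
      = altSum (m - 1) (byDenominator lam) := by
  rcases m with _ | m
  · simp [altSum]
  · rw [Nat.add_sub_cancel, ← sum_part_eq_altSum lam m 3 (by omega) (by omega)]
    simp only [Nat.odd_iff, Nat.reduceMod]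

theorem sum_eq_altSum_add {k : ℕ} (lam : Fin k → ℤ) :
    ∑ i, lam i = altSum k (byDenominator lam) + altSum (k - 1) (byDenominator lam) := by
  rcases k with _ | m
  · simp [altSum]
  · have h1 : ∑ i, lam i = ∑ i ∈ Finset.Icc 1 (m + 1), part lam i := by
      rw [← Finset.Ico_add_one_right_eq_Icc, Finset.sum_Ico_eq_sum_range, Finset.sum_range]
      refine Finset.sum_congr rfl fun i _ => ?_
      rw [part, dif_pos (by omega)]
      congr 1
      ext
      simp
    rw [h1, ← Finset.sum_filter_add_sum_filter_not _ (fun i => i % 2 = 1 % 2),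
      sum_part_eq_altSum lam (m + 1) 1 le_rfl rfl, Nat.add_sub_cancel, ← sum_even_part]
    congr 1
    refine Finset.sum_congr ?_ fun _ _ => rfl
    ext i
    simp only [Finset.mem_filter, Finset.mem_Icc, Nat.even_iff]
    omega

/-- The lower bound on the first part in `lectureHallVariation`, with `m = k - 1`. -/
def firstPartBound (m : ℕ) (l j : ℤ) (b : ℕ → ℤ) : ℤ :=
  l * (b m + ceilRatio b m) + (j - 1) * altSum m b + (l - 1) * altSum (m - 1) b

theorem firstPartBound_trunc (m : ℕ) (l j : ℤ) (b : ℕ → ℤ) :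
    firstPartBound m l j (trunc m b) = firstPartBound m l j b := by
  have e := trunc_apply b (le_refl m)
  rw [firstPartBound, firstPartBound, altSum_trunc le_rfl, altSum_trunc (Nat.sub_le m 1),
    ceilRatio_congr e, e]

theorem chain_iff {m : ℕ} (lam : Fin (m + 1) → ℤ) :
    ((∀ i : ℕ, 2 ≤ i → i < m + 1 →
      (part lam i : ℚ) / (((m + 1 : ℕ) : ℚ) - i + 1)
        ≥ (part lam (i + 1) : ℚ) / (((m + 1 : ℕ) : ℚ) - i)) ↔
    ∀ p, 1 ≤ p → p < m → byDenominator lam p + ceilRatio (byDenominator lam) p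
      ≤ byDenominator lam (p + 1)) := by
  have key : ∀ p i : ℕ, 1 ≤ p → p + i = m + 1 →
      ((part lam i : ℚ) / (((m + 1 : ℕ) : ℚ) - i + 1)
        ≥ (part lam (i + 1) : ℚ) / (((m + 1 : ℕ) : ℚ) - i) ↔
      byDenominator lam p + ceilRatio (byDenominator lam) p ≤ byDenominator lam (p + 1)) := by
    intro p i hp h
    have hp' : (0 : ℚ) < p := by exact_mod_cast hp
    have hi : ((m + 1 : ℕ) : ℚ) - i = p := by
      rw [← h]
      push_cast
      ring
    rw [ceilRatio, add_ceil_div_le_iff p hp, hi, ge_iff_le,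
      div_le_div_iff₀ hp' (by positivity), byDenominator, byDenominator,
      show m + 1 + 1 - p = i + 1 by omega, show m + 1 + 1 - (p + 1) = i by omega,
      ← @Int.cast_le ℚ]
    push_cast
    rw [mul_comm (part lam (i + 1) : ℚ), mul_comm (part lam i : ℚ)]
  constructor
  · intro h p h1 h2
    exact (key p (m + 1 - p) h1 (by omega)).1 (h _ (by omega) (by omega))
  · intro h i h1 h2
    exact (key (m + 1 - i) i (by omega) (by omega)).2 (h _ (by omega) (by omega))

/-- (m + 1) x / m = x + x / m, and the integer x leaves the ceiling. For m = 0 both sides vanish,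
since part 2 does not exist. -/
theorem ceil_second_part {m : ℕ} (lam : Fin (m + 1) → ℤ) :
    ⌈((m + 1 : ℕ) : ℚ) * (part lam 2 : ℚ) / (((m + 1 : ℕ) : ℚ) - 1)⌉
      = byDenominator lam m + ceilRatio (byDenominator lam) m := by
  have e : byDenominator lam m = part lam 2 := by
    rw [byDenominator, show m + 1 + 1 - m = 2 by omega]
  rcases Nat.eq_zero_or_pos m with rfl | hm
  · simp [byDenominator, ceilRatio, part]
  · have hm' : (m : ℚ) ≠ 0 := by exact_mod_cast hm.ne'
    rw [ceilRatio, e, ← Int.ceil_intCast_add]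
    congr 1
    push_cast
    rw [add_sub_cancel_right, add_mul, one_mul, add_div, mul_div_cancel_left₀ _ hm']

theorem mem_lectureHallVariation_iff {m : ℕ} {l j : ℤ} {lam : Fin (m + 1) → ℤ} :
    lam ∈ lectureHallVariation (m + 1) l j ↔
      byDenominator lam ∈ extension m (firstPartBound m l j) := by
  have h0 : byDenominator lam 0 = 0 := by simp [byDenominator, part]
  have hout : ∀ p, m + 1 < p → byDenominator lam p = 0 := by
    intro p hp
    rw [byDenominator, show m + 1 + 1 - p = 0 by omega]
    simp [part]
  have e1 : part lam (m + 1) = byDenominator lam 1 := rfl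
  have e2 : part lam 1 = byDenominator lam (m + 1) := by
    rw [byDenominator, Nat.add_sub_cancel_left]
  simp only [lectureHallVariation, extension, Set.mem_ofPred_eq, chain_iff, ceil_second_part,
    sum_even_part, sum_odd_part, e1, e2, trunc_mem_lectureHall_iff, firstPartBound_trunc]
  rw [ge_iff_le, ← firstPartBound]
  constructor
  · rintro ⟨h1, h2, h3⟩
    refine ⟨⟨h0, fun p hp => ?_⟩, h1, hout⟩
    rcases Nat.eq_zero_or_pos p with rfl | h
    · rwa [h0, ceilRatio_zero]
    · exact h2 p h hp
  · rintro ⟨⟨-, h1⟩, h2, -⟩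
    refine ⟨h2, fun p _ hp => h1 p hp, ?_⟩
    -- If m = 0 the last part is the first part, whose bound is 0; otherwise its sign is the chain
    -- inequality at p = 0.
    rcases Nat.eq_zero_or_pos m with rfl | h
    · simpa [firstPartBound, altSum, h0, ceilRatio_zero] using h2
    · simpa [h0, ceilRatio_zero] using h1 0 h

theorem byDenominator_bijOn (m : ℕ) (l j : ℤ) :
    Set.BijOn byDenominator (lectureHallVariation (m + 1) l j)
      (extension m (firstPartBound m l j)) := by
  refine ⟨fun lam h => mem_lectureHallVariation_iff.1 h, byDenominator_injective.injOn, ?_⟩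
  intro b hb
  obtain ⟨lam, rfl⟩ := exists_byDenominator_eq (trunc_mem_lectureHall_iff.1 hb.1).1 hb.2.2
  exact ⟨lam, mem_lectureHallVariation_iff.2 hb, rfl⟩

/-! ### Nonnegativity of the parts -/

theorem altSum_le_altSum_succ {m : ℕ} {b : ℕ → ℤ} (hb : b ∈ lectureHall m) (p : ℕ) (hp : p < m) :
    altSum p b ≤ altSum (p + 1) b := by
  induction p using Nat.twoStepInduction with
  | zero => exact lectureHall_nonneg hb 1
  | one =>
    have h1 := hb.2.1 1 hp
    have h2 := ceilRatio_nonneg (lectureHall_nonneg hb 1)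
    simp only [altSum]
    linarith
  | more p ih _ =>
    have h1 := hb.2.1 (p + 2) hp
    have h2 := ceilRatio_nonneg (lectureHall_nonneg hb (p + 2))
    have h3 := ih (by omega)
    simp only [altSum]
    linarith

theorem firstPartBound_nonneg {m : ℕ} {l j : ℤ} (hl : 0 < l) (hj : 2 - l ≤ j) {b : ℕ → ℤ}
    (hb : b ∈ lectureHall m) : 0 ≤ firstPartBound m l j b := by
  rcases m with _ | m
  · simp [firstPartBound, altSum, hb.1, ceilRatio_zero]
  · have hb0 := lectureHall_nonneg hb
    have h1 := ceilRatio_nonneg (hb0 (m + 1))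
    have h2 : altSum (m - 1) b ≤ altSum m b := by
      rcases m with _ | m
      · simp [altSum]
      · exact altSum_le_altSum_succ hb m (by omega)
    have h3 : 0 ≤ altSum (m + 1) b := by
      have : ∀ p, p ≤ m + 1 → 0 ≤ altSum p b := by
        intro p
        induction p with
        | zero => simp [altSum]
        | succ p ih =>
          intro hp
          exact (ih (by omega)).trans (altSum_le_altSum_succ hb p (by omega))
      exact this _ le_rfl
    have e := altSum_succ m b
    -- The bound is the sum of the terms in `h4` to `h7`. By `e` the second factor here is `altSum m
    -- b - altSum (m - 1) b`; `h5` is where j ≥ 2 - l enters.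
    have h4 : 0 ≤ (l - 1) * (b (m + 1) - altSum (m + 1) b + altSum m b) :=
      mul_nonneg (by omega) (by omega)
    have h5 : 0 ≤ (j - 1 + (l - 1)) * altSum (m + 1) b := mul_nonneg (by omega) h3
    have h6 : 0 ≤ l * ceilRatio b (m + 1) := mul_nonneg hl.le h1
    have h7 := hb0 (m + 1)
    rw [firstPartBound, Nat.add_sub_cancel]
    linarith

theorem lectureHallVariation_nonneg {m : ℕ} {l j : ℤ} (hl : 0 < l) (hj : 2 - l ≤ j)
    {lam : Fin (m + 1) → ℤ} (h : lam ∈ lectureHallVariation (m + 1) l j) (i : Fin (m + 1)) :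
    0 ≤ lam i := by
  have hb := mem_lectureHallVariation_iff.1 h
  have e : lam i = byDenominator lam (m + 1 - i) := by
    rw [byDenominator, show m + 1 + 1 - (m + 1 - i) = i + 1 by omega, part, dif_pos (by omega)]
    rfl
  rw [e]
  rcases Nat.eq_zero_or_pos (i : ℕ) with hi | hi
  · rw [hi]
    exact (firstPartBound_nonneg hl hj hb.1).trans hb.2.1
  · rw [← trunc_apply (m := m) (byDenominator lam) (by omega)]
    exact lectureHall_nonneg hb.1 _

/-! ### The generating function of the variation -/

theorem hasGenFun_lectureHallVariation (m : ℕ) (l j : ℤ) (hl : 0 < l) (hj : 2 - l ≤ j) :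
    HasGenFun (lectureHallVariation (m + 1) l j) (fun lam => ∑ i, lam i)
      ((1 - PowerSeries.X)⁻¹ * ∏ i ∈ Finset.range m,
        (1 - PowerSeries.X ^ ((i : ℤ) * (l + j) + (2 * l + j)).toNat)⁻¹) := by
  have h := (hasGenFun_lectureHall m (2 * l + j) (-l) (by omega) (by omega)).reflect.nat_prod
    one_pos
  rw [pow_one, show 2 * l + j + -l = l + j by ring] at h
  -- The remaining parts weigh `altSum m + altSum (m - 1)`, which raises the coefficients j - 1 and
  -- l - 1 of the bound to j and l: exactly the reflected weight.
  have hw : ∀ x ∈ {x : ℕ × (ℕ → ℤ) | x.2 ∈ lectureHall m},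
      altSum (m + 1) (extend m (firstPartBound m l j) x)
        + altSum m (extend m (firstPartBound m l j) x)
      = (1 : ℕ) * (x.1 : ℤ)
        + (l * (x.2 m + ceilRatio x.2 m) + j * altSum m x.2 + l * altSum (m - 1) x.2) := by
    intro x hx
    rw [altSum_succ, extend_last, ← altSum_trunc (Nat.sub_le m 1), ← altSum_trunc (le_refl m),
      trunc_extend _ hx, firstPartBound]
    push_cast
    ring
  have hext := h.of_bijOn (v := fun b => altSum (m + 1) b + altSum m b)
    (extend_bijOn m (firstPartBound m l j)) hw
  have hbij := byDenominator_bijOn m l j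
  have hinv := hbij.invOn_invFunOn
  refine hext.of_bijOn (hinv.symm.bijOn hbij.surjOn.mapsTo_invFunOn hbij.mapsTo) fun b hb => ?_
  rw [sum_eq_altSum_add, hinv.2 hb, Nat.add_sub_cancel]

theorem corollary8 (k : ℕ) (hk : 1 ≤ k) (l j : ℤ) (hl : 0 < l) (hj : 2 - l ≤ j) :
    (∀ lam ∈ lectureHallVariation k l j, ∀ i, 0 ≤ lam i) ∧
    (∀ n : ℕ, (ofWeight (lectureHallVariation k l j) n).Finite) ∧
    weightGenFun (lectureHallVariation k l j) =
      (1 - PowerSeries.X)⁻¹ *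
        ∏ i ∈ Finset.Icc 1 (k - 1),
          (1 - PowerSeries.X ^ ((i : ℤ) * l + (i : ℤ) * j + l).toNat)⁻¹ := by
  obtain ⟨m, rfl⟩ := Nat.exists_eq_add_of_le' hk
  have h := hasGenFun_lectureHallVariation m l j hl hj
  refine ⟨fun lam hlam i => lectureHallVariation_nonneg hl hj hlam i, h.2.1, ?_⟩
  have hprod : ∏ i ∈ Finset.Icc 1 (m + 1 - 1),
      (1 - PowerSeries.X ^ ((i : ℤ) * l + (i : ℤ) * j + l).toNat : PowerSeries ℚ)⁻¹
      = ∏ i ∈ Finset.range m,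
        (1 - PowerSeries.X ^ ((i : ℤ) * (l + j) + (2 * l + j)).toNat)⁻¹ := by
    rw [Nat.add_sub_cancel, ← Finset.Ico_add_one_right_eq_Icc, Finset.prod_Ico_eq_prod_range,
      Nat.add_sub_cancel]
    refine Finset.prod_congr rfl fun i _ => ?_
    congr 4
    push_cast
    ring
  rw [hprod]
  ext n
  rw [h.2.2 n, weightGenFun, PowerSeries.coeff_mk]
  rfl
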